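/- Let $Q_0=[0,1]$ carry Lebesgue measure, and let $\mathcal D(Q_0)$ be the collection of its dyadic subintervals $[j2^{-k},(j+1)2^{-k})$, $k\ge 0$, $0\le j<2^k$; for $K\in\mathcal D(Q_0)$ put $\mathcal D(K)=\{Q\in\mathcal D(Q_0):Q\subseteq K\}$. Write $\langle\cdot\rangle_Q=\frac1{|Q|}\int_Q\cdot\,dx$ for the (entrywise) average over $Q$ of a vector- or matrix-valued function. A $d\times d$ matrix weight is an entrywise integrable function $W:Q_0\to\mathbb C^{d\times d}$ with $W(x)$ positive semidefinite for almost every $x$. For every dimension $d$ and every $A\ge 0$ there is a finite constant $B=B(A)$ (depending only on $A$ and on $d$) with the following property. Let $(\alpha_Q)_{Q\in\mathcal D(Q_0)}$ be non-negative scalars with $$\frac1{|K|}\sum_{Q\in\mathcal D(K)}\alpha_Q\le A\qquad\text{for all }K\in\mathcal D(Q_0),$$ and let $W$ be a $d\times d$ matrix weight such that $W(x)$ is invertible for almost every $x$ and $W^{-1}$ is also entrywise integrable on $Q_0$. Then for all $f,g\in L^2(Q_0;\mathbb C^d)$ $$\sum_{Q\in\mathcal D(Q_0)}\alpha_Q\Big|\Big\langle\langle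 W\rangle_Q^{-1}\langle W^{1/2}f\rangle_Q,\ \langle W^{-1}\rangle_Q^{-1}\langle W^{-1/2}g\rangle_Q\Big\rangle_{\mathbb C^d}\Big|\le B\,\|f\|_{L^2(\mathbb C^d)}\|g\|_{L^2(\mathbb C^d)}.$$ -/

import Mathlib

open MeasureTheory
open scoped ENNReal NNReal MatrixOrder ComplexOrder

noncomputable section

/-- A dyadic subinterval of the unit interval `Q₀`: generation `level` and position
`pos ∈ {0, …, 2 ^ level - 1}`. -/
structure DyadicInterval where
  /-- The generation `k`; the interval has length `2⁻ᵏ`. -/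
  level : ℕ
  /-- The position of the interval among the `2 ^ k` intervals of its generation. -/
  pos : Fin (2 ^ level)

namespace DyadicInterval

/-- The half-open interval `[j 2⁻ᵏ, (j + 1) 2⁻ᵏ)`. -/
def toSet (Q : DyadicInterval) : Set ℝ :=
  Set.Ico ((Q.pos : ℝ) / 2 ^ Q.level) (((Q.pos : ℝ) + 1) / 2 ^ Q.level)

end DyadicInterval

/-- Lebesgue measure on `Q₀ = [0, 1]`. -/
def unitVolume : Measure ℝ := volume.restrict (Set.Icc 0 1)

/-- A `d × d` matrix weight on `Q₀`: entrywise integrable and almost everywhere positive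
semidefinite. -/
structure IsMatrixWeight {d : ℕ} (W : ℝ → Matrix (Fin d) (Fin d) ℂ) : Prop where
  integrable : ∀ i j, Integrable (fun x => W x i j) unitVolume
  posSemidef : ∀ᵐ x ∂unitVolume, (W x).PosSemidef

/-- The entrywise average `⟨W⟩_Q` of a matrix function. -/
def matrixAverage {d : ℕ} (W : ℝ → Matrix (Fin d) (Fin d) ℂ) (Q : DyadicInterval) :
    Matrix (Fin d) (Fin d) ℂ :=
  Matrix.of fun i j => ⨍ x in Q.toSet, W x i j

/-- The average `⟨f⟩_Q` of a vector function. -/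
def vectorAverage {d : ℕ} (f : ℝ → EuclideanSpace ℂ (Fin d)) (Q : DyadicInterval) :
    EuclideanSpace ℂ (Fin d) :=
  ⨍ x in Q.toSet, f x

/-- The vector `⟨W⟩_Q⁻¹ ⟨W^{1/2} f⟩_Q`. For the weight `W⁻¹` this is
`⟨W⁻¹⟩_Q⁻¹ ⟨W^{-1/2} f⟩_Q`, since `W^{-1/2} = (W⁻¹)^{1/2}` for positive definite `W`. -/
def weightedAverage {d : ℕ} (W : ℝ → Matrix (Fin d) (Fin d) ℂ)
    (f : ℝ → EuclideanSpace ℂ (Fin d)) (Q : DyadicInterval) : EuclideanSpace ℂ (Fin d) :=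
  Matrix.toEuclideanLin (matrixAverage W Q)⁻¹
    (vectorAverage (fun x => Matrix.toEuclideanLin (CFC.sqrt (W x)) (f x)) Q)

/-- `(1 / |K|) ∑_{Q ⊆ K} α_Q ≤ A` for every dyadic interval `K`. -/
def IsCarlesonSequence (α : DyadicInterval → ℝ≥0) (A : ℝ≥0) : Prop :=
  ∀ K : DyadicInterval,
    (volume K.toSet)⁻¹ * ∑' Q : {Q : DyadicInterval // Q.toSet ⊆ K.toSet}, (α Q : ℝ≥0∞) ≤ A

end

/-! The proof is a Bellman-type induction from small intervals to large ones. Write `V`, `V'` for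
the integrals of `W`, `W⁻¹` over `Q`, `F`, `F'` for those of `W^{1/2} f`, `W^{-1/2} g`, and `a` for
the Carleson constant. Each interval carries reservoirs `0 ≤ U ≤ a V` and `0 ≤ U' ≤ a V'` that
jointly dominate the unused Carleson mass times the duality pairing. At the bottom of a truncated
tree they are `a V` and `a V'`. At `Q` the children's reservoirs are added and a fraction `D`, `D'`
is spent so that it dominates `α Q` times the pairing; the term at `Q` is then at most `t D(V⁻¹F) +
t⁻¹ D'(V'⁻¹F')`.

This cost is paid by the decrease of the energy `∑ₛ ⟨(V + s M)⁻¹F, F⟩`, `s = 1, …, d + 1`, where `M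
= a V - U` is the part already spent. Since `⟨X⁻¹v, v⟩` is the supremum over `w` of `2 Re⟨v, w⟩ - ⟨X
w, w⟩`, the energy is subadditive over children, with gain `∑ₛ s D((V + s M)⁻¹F)`
(`regularizedEnergy_add_le`).

The gain sees regularized vectors rather than `V⁻¹F`. The entries of `adj(V + s M)` are polynomials
in `s` of degree at most `d`, so the value at `s = 0` is a fixed combination of those at `s = 1, …,
d + 1`; the determinant ratios are bounded because `M ≤ a V` (`exists_quadForm_inv_mulVec_le`). The
induction bounds every truncated sum by a multiple of `t‖f‖² + t⁻¹‖g‖²`, and `t` is then optimized.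
-/

theorem Complex.exists_norm_eq_one_re_mul_eq_norm (z : ℂ) : ∃ c : ℂ, ‖c‖ = 1 ∧ (c * z).re = ‖z‖ := by
  by_cases hz : z = 0
  · exact ⟨1, by simp, by simp [hz]⟩
  · have hz' : (‖z‖ : ℂ) ≠ 0 := by simpa using hz
    refine ⟨star z / ‖z‖, by simp [hz], ?_⟩
    rw [div_mul_eq_mul_div, Complex.star_def, Complex.conj_mul', pow_two, mul_div_assoc,
      div_self hz', mul_one, Complex.ofReal_re]

/-! ### Quadratic forms, the variational formula and determinants -/

namespace Matrix

section QuadForm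

variable {n : Type*} [Fintype n]

/-- The real quadratic form `w ↦ Re ⟨X w, w⟩` of a complex matrix. -/
def quadForm (X : Matrix n n ℂ) (w : n → ℂ) : ℝ := (star w ⬝ᵥ X *ᵥ w).re

theorem quadForm_add (X Y : Matrix n n ℂ) (w : n → ℂ) :
    quadForm (X + Y) w = quadForm X w + quadForm Y w := by
  simp [quadForm, add_mulVec, dotProduct_add]

theorem quadForm_sub (X Y : Matrix n n ℂ) (w : n → ℂ) :
    quadForm (X - Y) w = quadForm X w - quadForm Y w := by
  simp [quadForm, sub_mulVec, dotProduct_sub]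

theorem quadForm_smul (c : ℝ) (X : Matrix n n ℂ) (w : n → ℂ) :
    quadForm (c • X) w = c * quadForm X w := by
  simp [quadForm, smul_mulVec, dotProduct_smul]

theorem quadForm_smul_vec (c : ℂ) (X : Matrix n n ℂ) (w : n → ℂ) :
    quadForm X (c • w) = ‖c‖ ^ 2 * quadForm X w := by
  have h : star c * c = ((‖c‖ ^ 2 : ℝ) : ℂ) := by
    rw [Complex.star_def, Complex.conj_mul']; push_cast; rfl
  rw [quadForm, quadForm, mulVec_smul, star_smul, smul_dotProduct, dotProduct_smul, smul_smul, h,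
    smul_eq_mul, Complex.re_ofReal_mul]

theorem PosSemidef.quadForm_nonneg {X : Matrix n n ℂ} (hX : X.PosSemidef) (w : n → ℂ) :
    0 ≤ quadForm X w :=
  (Complex.le_def.1 (hX.dotProduct_mulVec_nonneg w)).1

theorem IsHermitian.star_dotProduct_mulVec {X : Matrix n n ℂ} (hX : X.IsHermitian)
    (v w : n → ℂ) : star v ⬝ᵥ X *ᵥ w = star (star w ⬝ᵥ X *ᵥ v) := by
  rw [star_dotProduct, star_mulVec, hX.eq, ← dotProduct_mulVec]

theorem IsHermitian.quadForm_sub_vec {X : Matrix n n ℂ} (hX : X.IsHermitian) (v w : n → ℂ) :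
    quadForm X (v - w) = quadForm X v + quadForm X w - 2 * (star w ⬝ᵥ X *ᵥ v).re := by
  have h : (star v ⬝ᵥ X *ᵥ w).re = (star w ⬝ᵥ X *ᵥ v).re := by
    rw [hX.star_dotProduct_mulVec v w, Complex.star_def, Complex.conj_re]
  simp only [quadForm, star_sub, mulVec_sub, sub_dotProduct, dotProduct_sub, Complex.sub_re, h]
  ring

theorem PosSemidef.quadForm_add_vec_le {X : Matrix n n ℂ} (hX : X.PosSemidef) (v w : n → ℂ) :
    quadForm X (v + w) ≤ 2 * (quadForm X v + quadForm X w) := by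
  have h1 := hX.quadForm_nonneg (v - w)
  have h2 := hX.isHermitian.quadForm_sub_vec v w
  have h3 := hX.isHermitian.quadForm_sub_vec v (-w)
  have h4 : quadForm X (-w) = quadForm X w := by simp [quadForm, mulVec_neg]
  rw [sub_neg_eq_add, h4, star_neg, neg_dotProduct, Complex.neg_re] at h3
  linarith

theorem PosSemidef.quadForm_sum_le {X : Matrix n n ℂ} (hX : X.PosSemidef) {ι : Type*}
    (s : Finset ι) (v : ι → n → ℂ) :
    quadForm X (∑ k ∈ s, v k) ≤ 2 ^ s.card * ∑ k ∈ s, quadForm X (v k) := by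
  classical
  induction s using Finset.induction_on with
  | empty => simp [quadForm]
  | insert a s ha ih =>
    rw [Finset.sum_insert ha, Finset.sum_insert ha, Finset.card_insert_of_notMem ha]
    have h1 := hX.quadForm_add_vec_le (v a) (∑ k ∈ s, v k)
    have h2 : (1 : ℝ) ≤ 2 ^ s.card := one_le_pow₀ (by norm_num)
    have h3 := mul_le_mul_of_nonneg_right h2 (hX.quadForm_nonneg (v a))
    rw [pow_succ]
    linarith

variable [DecidableEq n]

theorem PosDef.isUnit_det {X : Matrix n n ℂ} (hX : X.PosDef) : IsUnit X.det :=
  (isUnit_iff_isUnit_det X).1 hX.isUnit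

theorem PosDef.mulVec_inv_mulVec {X : Matrix n n ℂ} (hX : X.PosDef) (v : n → ℂ) :
    X *ᵥ (X⁻¹ *ᵥ v) = v := by
  rw [mulVec_mulVec, mul_nonsing_inv _ hX.isUnit_det, one_mulVec]

theorem PosDef.quadForm_inv_mulVec {X : Matrix n n ℂ} (hX : X.PosDef) (v : n → ℂ) :
    quadForm X (X⁻¹ *ᵥ v) = quadForm X⁻¹ v := by
  have h := hX.inv.isHermitian.star_dotProduct_mulVec v v
  rw [quadForm, hX.mulVec_inv_mulVec, quadForm, h, star_dotProduct]

/-- The easy half of the variational formula for the form of the inverse matrix. -/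
theorem PosDef.two_re_dotProduct_sub_le {X : Matrix n n ℂ} (hX : X.PosDef) (v w : n → ℂ) :
    2 * (star w ⬝ᵥ v).re - quadForm X w ≤ quadForm X⁻¹ v := by
  have h1 := hX.posSemidef.quadForm_nonneg (X⁻¹ *ᵥ v - w)
  rw [hX.isHermitian.quadForm_sub_vec, hX.mulVec_inv_mulVec, hX.quadForm_inv_mulVec] at h1
  linarith

/-- The other half: the supremum in the variational formula is attained at `X⁻¹ v`. -/
theorem PosDef.two_re_dotProduct_sub_eq {X : Matrix n n ℂ} (hX : X.PosDef) (v : n → ℂ) :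
    2 * (star (X⁻¹ *ᵥ v) ⬝ᵥ v).re - quadForm X (X⁻¹ *ᵥ v) = quadForm X⁻¹ v := by
  have h : quadForm X (X⁻¹ *ᵥ v) = (star (X⁻¹ *ᵥ v) ⬝ᵥ v).re := by
    rw [quadForm, hX.mulVec_inv_mulVec]
  have h' := hX.quadForm_inv_mulVec v
  linarith

/-- The joint subadditivity of `(X, v) ↦ ⟨X⁻¹ v, v⟩`, with the gain produced by an additional
summand `D` of the matrix. -/
theorem PosDef.quadForm_inv_add_add_le {X Y D : Matrix n n ℂ} (hX : X.PosDef) (hY : Y.PosDef)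
    (hD : (X + Y + D).PosDef) (u v : n → ℂ) :
    quadForm (X + Y + D)⁻¹ (u + v) + quadForm D ((X + Y + D)⁻¹ *ᵥ (u + v)) ≤
      quadForm X⁻¹ u + quadForm Y⁻¹ v := by
  -- The maximizer for the total matrix is used as a competitor for `X` and for `Y`; the form of `D`
  -- at it is left over as the gain.
  set w := (X + Y + D)⁻¹ *ᵥ (u + v) with hw
  have h := hD.two_re_dotProduct_sub_eq (u + v)
  have h1 := hX.two_re_dotProduct_sub_le u w
  have h2 := hY.two_re_dotProduct_sub_le v w
  rw [← hw, quadForm_add, quadForm_add, dotProduct_add, Complex.add_re] at h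
  linarith

/-- Rotating `w` by a phase turns the real part in the variational inequality into a modulus and
leaves the form unchanged. -/
theorem PosDef.two_norm_dotProduct_le {X : Matrix n n ℂ} (hX : X.PosDef) (w v : n → ℂ) :
    2 * ‖star w ⬝ᵥ v‖ ≤ quadForm X w + quadForm X⁻¹ v := by
  obtain ⟨c, hc, hcz⟩ := Complex.exists_norm_eq_one_re_mul_eq_norm (star w ⬝ᵥ v)
  have h := hX.two_re_dotProduct_sub_le v (star c • w)
  rw [star_smul, star_star, smul_dotProduct, smul_eq_mul, hcz, quadForm_smul_vec, norm_star, hc]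
    at h
  linarith

/-- Monotonicity of the determinant, in a quantitative form. -/
theorem PosDef.norm_det_le {W X : Matrix n n ℂ} (hW : W.PosDef) (hX : X.PosSemidef) {c : ℝ}
    (hc : (c • W - X).PosSemidef) : ‖X.det‖ ≤ c ^ Fintype.card n * ‖W.det‖ := by
  set S := CFC.sqrt W with hS
  have hSp : S.PosSemidef := nonneg_iff_posSemidef.1 (CFC.sqrt_nonneg W)
  have hSS : S * S = W := CFC.sqrt_mul_sqrt_self W hW.posSemidef.nonneg
  have hSd : IsUnit S.det := by
    have := hW.isUnit_det
    rw [← hSS, det_mul] at this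
    exact isUnit_of_mul_isUnit_left this
  have hSi : (S⁻¹)ᴴ = S⁻¹ := hSp.isHermitian.inv.eq
  -- Conjugation by `W^{-1/2}` turns `0 ≤ X ≤ c W` into `0 ≤ Y ≤ c`, so the eigenvalues of `Y` lie
  -- in `[0, c]`.
  set Y := S⁻¹ * X * S⁻¹ with hY
  have hYp : Y.PosSemidef := by
    have := hX.conjTranspose_mul_mul_same S⁻¹
    rwa [hSi] at this
  have hYc : (c • (1 : Matrix n n ℂ) - Y).PosSemidef := by
    have := hc.conjTranspose_mul_mul_same S⁻¹
    rw [hSi, mul_sub, sub_mul, ← hY, mul_smul_comm, smul_mul_assoc, ← hSS, ← mul_assoc,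
      nonsing_inv_mul _ hSd, one_mul, mul_nonsing_inv _ hSd] at this
    exact this
  have hdet : X.det = W.det * Y.det := by
    rw [hY, ← hSS, det_mul, det_mul, det_mul, det_nonsing_inv]
    have h := Ring.mul_inverse_cancel _ hSd
    linear_combination (-X.det * (S.det * Ring.inverse S.det + 1)) * h
  have hle : ‖Y.det‖ ≤ c ^ Fintype.card n := by
    rw [hYp.isHermitian.det_eq_prod_eigenvalues, norm_prod, ← Finset.card_univ,
      ← Finset.prod_const]
    refine Finset.prod_le_prod (fun _ _ => norm_nonneg _) fun i _ => ?_
    have h0 := hYp.eigenvalues_nonneg i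
    have h1 : hYp.isHermitian.eigenvalues i ≤ c := by
      have h2 := hYp.isHermitian.eigenvalues_eq i
      have h3 := hYc.quadForm_nonneg (hYp.isHermitian.eigenvectorBasis i)
      rw [quadForm_sub, quadForm_smul] at h3
      have h4 : quadForm (1 : Matrix n n ℂ) (hYp.isHermitian.eigenvectorBasis i) = 1 := by
        have := hYp.isHermitian.eigenvectorBasis.orthonormal.1 i
        have h5 := inner_self_eq_norm_sq (𝕜 := ℂ) (hYp.isHermitian.eigenvectorBasis i)
        rw [this, EuclideanSpace.inner_eq_star_dotProduct, dotProduct_comm] at h5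
        rw [quadForm, one_mulVec]
        simpa using h5
      rw [h4] at h3
      have h6 : quadForm Y (hYp.isHermitian.eigenvectorBasis i) =
        hYp.isHermitian.eigenvalues i := h2.symm
      linarith
    simpa [abs_of_nonneg h0] using h1
  rw [hdet, norm_mul, mul_comm]
  exact mul_le_mul_of_nonneg_right hle (norm_nonneg _)

end QuadForm

end Matrix

/-! ### Recovering `W⁻¹ v` from regularized inverses -/

/-- Extrapolation to `0` of polynomials of bounded degree from the nodes `1, …, N + 1`. -/
theorem Polynomial.exists_eval_zero_eq_sum (N : ℕ) :
    ∃ c : ℕ → ℂ, ∀ p : Polynomial ℂ, p.natDegree ≤ N →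
      p.eval 0 = ∑ k ∈ Finset.range (N + 1), c k * p.eval ((k : ℂ) + 1) := by
  let node : ℕ → ℂ := fun k => (k : ℂ) + 1
  refine ⟨fun k => (Lagrange.basis (Finset.range (N + 1)) node k).eval 0, fun p hp => ?_⟩
  have hinj : Set.InjOn node (Finset.range (N + 1)) := fun a _ b _ h => by
    simpa [node] using h
  have hdeg : p.degree < (Finset.range (N + 1)).card := by
    rw [Finset.card_range]
    exact (Polynomial.degree_le_of_natDegree_le hp).trans_lt (by exact_mod_cast Nat.lt_succ_self N)
  conv_lhs => rw [Lagrange.eq_interpolate hinj hdeg, Lagrange.interpolate_apply,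
    Polynomial.eval_finsetSum]
  refine Finset.sum_congr rfl fun k _ => ?_
  rw [Polynomial.eval_mul, Polynomial.eval_C, mul_comm]

namespace Matrix

variable {n : Type*} [Fintype n] [DecidableEq n]

/-- The entries of the adjugate of a linear matrix pencil are polynomials of bounded degree. -/
theorem exists_polynomial_adjugate (W M : Matrix n n ℂ) (i j : n) :
    ∃ p : Polynomial ℂ, p.natDegree ≤ Fintype.card n ∧
      ∀ s : ℂ, p.eval s = (W + s • M).adjugate i j := by
  -- The adjugate entry is the determinant with row `j` replaced by a basis vector. Putting that
  -- vector in `W` and zero in `M` keeps the pencil affine in `s`.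
  refine ⟨_, Polynomial.natDegree_det_X_add_C_le (M.updateRow j 0)
    (W.updateRow j (Pi.single i 1)), fun s => ?_⟩
  rw [adjugate_apply, ← Polynomial.coe_evalRingHom, RingHom.map_det]
  congr 1
  ext a b
  by_cases h : a = j
  · subst h; simp
  · simp [h]; ring

theorem exists_adjugate_eq_sum (n : Type*) [Fintype n] [DecidableEq n] :
    ∃ c : ℕ → ℂ, ∀ W M : Matrix n n ℂ, W.adjugate =
      ∑ k ∈ Finset.range (Fintype.card n + 1), c k • (W + ((k : ℂ) + 1) • M).adjugate := by
  obtain ⟨c, hc⟩ := Polynomial.exists_eval_zero_eq_sum (Fintype.card n)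
  refine ⟨c, fun W M => ?_⟩
  ext i j
  obtain ⟨p, hp, hpe⟩ := exists_polynomial_adjugate W M i j
  have h := hc p hp
  simp only [hpe, zero_smul, add_zero] at h
  rw [h, sum_apply]
  rfl

/-- The form `D` at `W⁻¹ v` is controlled by its values at the regularized vectors
`(W + s M)⁻¹ v`, `s = 1, …, d + 1`, as soon as `0 ≤ M ≤ a W`. -/
theorem exists_quadForm_inv_mulVec_le (n : Type*) [Fintype n] [DecidableEq n] (a : ℝ) :
    ∃ C : ℝ, 0 < C ∧ ∀ W M D : Matrix n n ℂ, W.PosDef → M.PosSemidef → (a • W - M).PosSemidef →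
      D.PosSemidef → ∀ v : n → ℂ, quadForm D (W⁻¹ *ᵥ v) ≤
        C * ∑ k ∈ Finset.range (Fintype.card n + 1),
          ((k : ℝ) + 1) * quadForm D ((W + ((k : ℝ) + 1) • M)⁻¹ *ᵥ v) := by
  obtain ⟨c, hc⟩ := exists_adjugate_eq_sum n
  set N := Fintype.card n
  -- Bounds the squared coefficient `r k` below, since `W + s M ≤ (1 + s a) W` controls the
  -- determinant ratio.
  let b : ℕ → ℝ := fun k => (‖c k‖ * (1 + ((k : ℝ) + 1) * a) ^ N) ^ 2
  have hb : ∀ k, 0 ≤ b k := fun k => sq_nonneg _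
  have hbs : 0 ≤ ∑ k ∈ Finset.range (N + 1), b k := Finset.sum_nonneg fun k _ => hb k
  -- The power of two is the loss in `quadForm_sum_le` for `N + 1` vectors; the extra `1` keeps the
  -- constant positive.
  refine ⟨2 ^ (N + 1) * (∑ k ∈ Finset.range (N + 1), b k + 1), by positivity,
    fun W M D hW hM hMW hD v => ?_⟩
  have hWk : ∀ k : ℕ, (W + ((k : ℝ) + 1) • M).PosDef := fun k =>
    hW.add_posSemidef (hM.smul (by positivity))
  have hdet : ∀ k : ℕ,
      ‖(W + ((k : ℝ) + 1) • M).det‖ ≤ (1 + ((k : ℝ) + 1) * a) ^ N * ‖W.det‖ := fun k => by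
    refine hW.norm_det_le (hWk k).posSemidef ?_
    have : (1 + ((k : ℝ) + 1) * a) • W - (W + ((k : ℝ) + 1) • M) =
        ((k : ℝ) + 1) • (a • W - M) := by
      rw [smul_sub, add_smul, one_smul, smul_smul]; abel
    rw [this]
    exact hMW.smul (by positivity)
  have hW0 : W.det ≠ 0 := hW.isUnit_det.ne_zero
  let r : ℕ → ℂ := fun k => c k * ((W + ((k : ℝ) + 1) • M).det / W.det)
  have hr : ∀ k, ‖r k‖ ^ 2 ≤ b k := fun k => by
    refine pow_le_pow_left₀ (norm_nonneg _) ?_ 2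
    rw [norm_mul, norm_div]
    refine mul_le_mul_of_nonneg_left ?_ (norm_nonneg _)
    rw [div_le_iff₀ (norm_pos_iff.2 hW0)]
    exact hdet k
  have hadj : ∀ X : Matrix n n ℂ, X.PosDef → X.adjugate = X.det • X⁻¹ := fun X hX => by
    rw [inv_def, smul_smul, Ring.mul_inverse_cancel _ hX.isUnit_det, one_smul]
  have hsum : W⁻¹ *ᵥ v =
      ∑ k ∈ Finset.range (N + 1), r k • ((W + ((k : ℝ) + 1) • M)⁻¹ *ᵥ v) := by
    have h1 : W.det • W⁻¹ = ∑ k ∈ Finset.range (N + 1),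
        (W.det * r k) • (W + ((k : ℝ) + 1) • M)⁻¹ := by
      rw [← hadj W hW, hc W M]
      refine Finset.sum_congr rfl fun k _ => ?_
      have h2 : ((k : ℂ) + 1) • M = ((k : ℝ) + 1) • M := by
        ext i j; simp
      rw [h2, hadj _ (hWk k), smul_smul]
      congr 1
      simp only [r]
      field_simp
    have h3 : W⁻¹ = ∑ k ∈ Finset.range (N + 1), r k • (W + ((k : ℝ) + 1) • M)⁻¹ := by
      have h4 := congrArg (fun X => (W.det)⁻¹ • X) h1
      simpa only [Finset.smul_sum, smul_smul, ← mul_assoc, inv_mul_cancel₀ hW0, one_mul,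
        one_smul] using h4
    conv_lhs => rw [h3, sum_mulVec]
    exact Finset.sum_congr rfl fun k _ => by rw [smul_mulVec]
  rw [hsum]
  refine (hD.quadForm_sum_le _ _).trans ?_
  rw [Finset.card_range, mul_assoc]
  refine mul_le_mul_of_nonneg_left ?_ (by positivity)
  rw [Finset.mul_sum]
  refine Finset.sum_le_sum fun k hk => ?_
  rw [quadForm_smul_vec]
  have hq := hD.quadForm_nonneg ((W + ((k : ℝ) + 1) • M)⁻¹ *ᵥ v)
  have h1 : b k ≤ ∑ k ∈ Finset.range (N + 1), b k :=
    Finset.single_le_sum (fun k _ => hb k) hk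
  -- The weights `s ≥ 1` are inserted only to match the gain in `regularizedEnergy_add_le`.
  have h2 : (1 : ℝ) ≤ (k : ℝ) + 1 := by simp
  calc _ ≤ (∑ k ∈ Finset.range (N + 1), b k + 1) *
        quadForm D ((W + ((k : ℝ) + 1) • M)⁻¹ *ᵥ v) :=
        mul_le_mul_of_nonneg_right (by linarith [hr k]) hq
    _ ≤ _ := mul_le_mul_of_nonneg_left (le_mul_of_one_le_left hq h2) (by positivity)

end Matrix

/-! ### Domination of the pairing and regularized energies -/

namespace Matrix

variable {n : Type*} [Fintype n]

/-- `X` and `Y` dominate `c` times the duality pairing: the block matrix with diagonal blocks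
`X`, `Y` and off-diagonal blocks `c • 1` is positive semidefinite. -/
def DominatesPairing (X Y : Matrix n n ℂ) (c : ℝ) : Prop :=
  ∀ v w : n → ℂ, 2 * c * ‖star v ⬝ᵥ w‖ ≤ quadForm X v + quadForm Y w

theorem DominatesPairing.add {X X' Y Y' : Matrix n n ℂ} {c c' : ℝ}
    (h : DominatesPairing X Y c) (h' : DominatesPairing X' Y' c') :
    DominatesPairing (X + X') (Y + Y') (c + c') := fun v w => by
  have h1 := h v w
  have h2 := h' v w
  rw [quadForm_add, quadForm_add]
  linarith

theorem DominatesPairing.smul {X Y : Matrix n n ℂ} {c : ℝ} (h : DominatesPairing X Y c)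
    {t : ℝ} (ht : 0 ≤ t) : DominatesPairing (t • X) (t • Y) (t * c) := fun v w => by
  have h1 := mul_le_mul_of_nonneg_left (h v w) ht
  rw [quadForm_smul, quadForm_smul]
  linarith

/-- The pairing is invariant under `v ↦ √t v`, `w ↦ w / √t`, while the two forms scale by `t` and
`t⁻¹`. -/
theorem DominatesPairing.le_mul_add_inv_mul {X Y : Matrix n n ℂ} {c : ℝ}
    (h : DominatesPairing X Y c) {t : ℝ} (ht : 0 < t) (v w : n → ℂ) :
    2 * c * ‖star v ⬝ᵥ w‖ ≤ t * quadForm X v + t⁻¹ * quadForm Y w := by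
  have hs : 0 < √t := Real.sqrt_pos.2 ht
  have h1 := h ((√t : ℂ) • v) (((√t)⁻¹ : ℂ) • w)
  rw [quadForm_smul_vec, quadForm_smul_vec, star_smul, smul_dotProduct, dotProduct_smul,
    smul_smul, Complex.star_def, Complex.conj_ofReal,
    mul_inv_cancel₀ (Complex.ofReal_ne_zero.2 hs.ne'), one_smul, norm_inv, Complex.norm_real,
    Real.norm_of_nonneg hs.le, inv_pow, Real.sq_sqrt ht.le] at h1
  exact h1

variable [DecidableEq n]

/-- The sum over `s = 1, …, d + 1` of the energies `⟨(V + s M)⁻¹ v, v⟩`. -/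
noncomputable def regularizedEnergy (V M : Matrix n n ℂ) (v : n → ℂ) : ℝ :=
  ∑ k ∈ Finset.range (Fintype.card n + 1), quadForm (V + ((k : ℝ) + 1) • M)⁻¹ v

theorem regularizedEnergy_zero (V : Matrix n n ℂ) (v : n → ℂ) :
    regularizedEnergy V 0 v = ((Fintype.card n : ℝ) + 1) * quadForm V⁻¹ v := by
  simp [regularizedEnergy]

theorem regularizedEnergy_nonneg {V M : Matrix n n ℂ} (hV : V.PosDef) (hM : M.PosSemidef)
    (v : n → ℂ) : 0 ≤ regularizedEnergy V M v :=
  Finset.sum_nonneg fun k _ =>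
    (hV.add_posSemidef (hM.smul
      (by positivity : (0 : ℝ) ≤ (k : ℝ) + 1))).inv.posSemidef.quadForm_nonneg v

theorem regularizedEnergy_add_le {V₁ V₂ M₁ M₂ D : Matrix n n ℂ} (hV₁ : V₁.PosDef)
    (hV₂ : V₂.PosDef) (hM₁ : M₁.PosSemidef) (hM₂ : M₂.PosSemidef) (hD : D.PosSemidef)
    (v₁ v₂ : n → ℂ) :
    regularizedEnergy (V₁ + V₂) (M₁ + M₂ + D) (v₁ + v₂) +
        ∑ k ∈ Finset.range (Fintype.card n + 1), ((k : ℝ) + 1) *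
          quadForm D ((V₁ + V₂ + ((k : ℝ) + 1) • (M₁ + M₂ + D))⁻¹ *ᵥ (v₁ + v₂)) ≤
      regularizedEnergy V₁ M₁ v₁ + regularizedEnergy V₂ M₂ v₂ := by
  rw [regularizedEnergy, regularizedEnergy, regularizedEnergy, ← Finset.sum_add_distrib,
    ← Finset.sum_add_distrib]
  refine Finset.sum_le_sum fun k _ => ?_
  have hk : (0 : ℝ) ≤ (k : ℝ) + 1 := by positivity
  have h1 := hV₁.add_posSemidef (hM₁.smul hk)
  have h2 := hV₂.add_posSemidef (hM₂.smul hk)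
  have h3 := (h1.add h2).add_posSemidef (hD.smul hk)
  have h4 := h1.quadForm_inv_add_add_le h2 h3 v₁ v₂
  have h5 : V₁ + ((k : ℝ) + 1) • M₁ + (V₂ + ((k : ℝ) + 1) • M₂) + ((k : ℝ) + 1) • D =
      V₁ + V₂ + ((k : ℝ) + 1) • (M₁ + M₂ + D) := by
    simp only [smul_add]; abel
  rwa [h5, quadForm_smul] at h4

end Matrix

/-! ### Induction on generations -/

namespace DyadicInterval

/-- The left half of a dyadic interval. -/
def left (Q : DyadicInterval) : DyadicInterval :=
  ⟨Q.level + 1, ⟨2 * Q.pos, by have := Q.pos.2; rw [pow_succ]; omega⟩⟩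

/-- The right half of a dyadic interval. -/
def right (Q : DyadicInterval) : DyadicInterval :=
  ⟨Q.level + 1, ⟨2 * Q.pos + 1, by have := Q.pos.2; rw [pow_succ]; omega⟩⟩

/-- The sum of `a` over the first `N` generations of dyadic subintervals of `Q`. -/
def treeSum {R : Type*} [AddMonoid R] (a : DyadicInterval → R) : ℕ → DyadicInterval → R
  | 0, _ => 0
  | N + 1, Q => a Q + (treeSum a N Q.left + treeSum a N Q.right)

/-- Additivity of a function of dyadic intervals. -/
def IsAdditive {R : Type*} [Add R] (a : DyadicInterval → R) : Prop :=
  ∀ Q, a Q = a Q.left + a Q.right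

end DyadicInterval

section TreeInduction

open DyadicInterval Matrix

/-- The integrals `V Q` of a matrix weight, `F Q` of a vector function, and the energies `e Q`,
with the properties on which the embedding theorem depends. -/
structure IsWeightedFamily {n : Type*} [Fintype n] [DecidableEq n]
    (V : DyadicInterval → Matrix n n ℂ) (F : DyadicInterval → n → ℂ) (e : DyadicInterval → ℝ) :
    Prop where
  posDef : ∀ Q, (V Q).PosDef
  weight_add : IsAdditive V
  vec_add : IsAdditive F
  energy_add : IsAdditive e
  le_energy : ∀ Q, quadForm (V Q)⁻¹ (F Q) ≤ e Q

/-- One step of the induction on generations for the energy of a single weighted family. -/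
theorem IsWeightedFamily.regularizedEnergy_step {n : Type*} [Fintype n] [DecidableEq n]
    {V : DyadicInterval → Matrix n n ℂ} {F : DyadicInterval → n → ℂ} {e : DyadicInterval → ℝ}
    (h : IsWeightedFamily V F e) {a C : ℝ} (hC0 : 0 < C)
    (hC : ∀ W M D : Matrix n n ℂ, W.PosDef → M.PosSemidef → (a • W - M).PosSemidef →
      D.PosSemidef → ∀ v : n → ℂ, quadForm D (W⁻¹ *ᵥ v) ≤
        C * ∑ k ∈ Finset.range (Fintype.card n + 1),
          ((k : ℝ) + 1) * quadForm D ((W + ((k : ℝ) + 1) • M)⁻¹ *ᵥ v))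
    (Q : DyadicInterval) {U₁ U₂ : Matrix n n ℂ} (hU₁ : U₁.PosSemidef) (hU₂ : U₂.PosSemidef)
    (hM₁ : (a • V Q.left - U₁).PosSemidef) (hM₂ : (a • V Q.right - U₂).PosSemidef)
    {t : ℝ} (ht0 : 0 ≤ t) (ht1 : t ≤ 1) :
    ((1 - t) • (U₁ + U₂)).PosSemidef ∧ (a • V Q - (1 - t) • (U₁ + U₂)).PosSemidef ∧
      C * regularizedEnergy (V Q) (a • V Q - (1 - t) • (U₁ + U₂)) (F Q) +
          quadForm (t • (U₁ + U₂)) ((V Q)⁻¹ *ᵥ F Q) ≤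
        C * regularizedEnergy (V Q.left) (a • V Q.left - U₁) (F Q.left) +
          C * regularizedEnergy (V Q.right) (a • V Q.right - U₂) (F Q.right) := by
  have hU := hU₁.add hU₂
  have hD : (t • (U₁ + U₂)).PosSemidef := hU.smul ht0
  have hU' : ((1 - t) • (U₁ + U₂)).PosSemidef := hU.smul (sub_nonneg.2 ht1)
  -- The spent part at `Q` is that of the two children plus the newly spent `D`.
  have hM : a • V Q - (1 - t) • (U₁ + U₂) =
      a • V Q.left - U₁ + (a • V Q.right - U₂) + t • (U₁ + U₂) := by
    rw [h.weight_add Q, smul_add, sub_smul, one_smul]; abel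
  have hMp : (a • V Q - (1 - t) • (U₁ + U₂)).PosSemidef := by
    rw [hM]; exact (hM₁.add hM₂).add hD
  refine ⟨hU', hMp, ?_⟩
  have h1 := regularizedEnergy_add_le (h.posDef Q.left) (h.posDef Q.right) hM₁ hM₂ hD
    (F Q.left) (F Q.right)
  have h2 := hC (V Q) _ _ (h.posDef Q) hMp (by rwa [sub_sub_cancel]) hD (F Q)
  rw [← hM, ← h.weight_add Q, ← h.vec_add Q] at h1
  have h3 := mul_le_mul_of_nonneg_left h1 hC0.le
  rw [mul_add, mul_add] at h3
  linarith

/-- The bilinear embedding on finitely many generations, for abstract weighted families in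
duality. -/
theorem exists_treeSum_pairing_le (n : Type*) [Fintype n] [DecidableEq n] {a : ℝ} (ha : 0 ≤ a) :
    ∃ K : ℝ, 0 < K ∧ ∀ (V V' : DyadicInterval → Matrix n n ℂ) (F F' : DyadicInterval → n → ℂ)
      (e e' α ℓ : DyadicInterval → ℝ), IsWeightedFamily V F e → IsWeightedFamily V' F' e' →
      IsAdditive ℓ → (∀ Q, DominatesPairing (V Q) (V' Q) (ℓ Q)) → (∀ Q, 0 ≤ α Q) →
      (∀ N Q, treeSum α N Q ≤ a * ℓ Q) → ∀ t : ℝ, 0 < t → ∀ N Q,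
        treeSum (fun Q => α Q * ‖star ((V Q)⁻¹ *ᵥ F Q) ⬝ᵥ ((V' Q)⁻¹ *ᵥ F' Q)‖) N Q ≤
          K * (t * e Q + t⁻¹ * e' Q) := by
  obtain ⟨C, hC0, hC⟩ := exists_quadForm_inv_mulVec_le n a
  refine ⟨C * ((Fintype.card n : ℝ) + 1), by positivity, ?_⟩
  intro V V' F F' e e' α ℓ hV hV' hℓ hpair hα hcarl t ht N Q
  set b : DyadicInterval → ℝ :=
    fun Q => α Q * ‖star ((V Q)⁻¹ *ᵥ F Q) ⬝ᵥ ((V' Q)⁻¹ *ᵥ F' Q)‖ with hb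
  have hti : 0 < t⁻¹ := inv_pos.2 ht
  -- Invariant: `U`, `U'` are what is left of `a V`, `a V'` after paying for `N` generations below
  -- `Q`, and they still dominate the unused mass.
  have key : ∀ N Q, ∃ U U' : Matrix n n ℂ, U.PosSemidef ∧ U'.PosSemidef ∧
      (a • V Q - U).PosSemidef ∧ (a • V' Q - U').PosSemidef ∧
      DominatesPairing U U' (a * ℓ Q - treeSum α N Q) ∧
      treeSum b N Q + (t * (C * regularizedEnergy (V Q) (a • V Q - U) (F Q)) +
          t⁻¹ * (C * regularizedEnergy (V' Q) (a • V' Q - U') (F' Q))) ≤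
        C * ((Fintype.card n : ℝ) + 1) * (t * e Q + t⁻¹ * e' Q) := by
    intro N
    induction N with
    | zero =>
      intro Q
      -- Nothing is spent yet, so `M = 0` and the energy is `d + 1` equal terms.
      refine ⟨a • V Q, a • V' Q, (hV.posDef Q).posSemidef.smul ha,
        (hV'.posDef Q).posSemidef.smul ha, by simpa using PosSemidef.zero,
        by simpa using PosSemidef.zero, by simpa [treeSum] using (hpair Q).smul ha, ?_⟩
      rw [sub_self, sub_self, regularizedEnergy_zero, regularizedEnergy_zero, treeSum, zero_add]
      have hc : 0 < C * ((Fintype.card n : ℝ) + 1) := by positivity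
      have h1 := mul_le_mul_of_nonneg_left (hV.le_energy Q) (mul_pos hc ht).le
      have h2 := mul_le_mul_of_nonneg_left (hV'.le_energy Q) (mul_pos hc hti).le
      linarith
    | succ N ih =>
      intro Q
      obtain ⟨U₁, U₁', hU₁, hU₁', hM₁, hM₁', hP₁, hE₁⟩ := ih Q.left
      obtain ⟨U₂, U₂', hU₂, hU₂', hM₂, hM₂', hP₂, hE₂⟩ := ih Q.right
      set u := a * ℓ Q.left - treeSum α N Q.left + (a * ℓ Q.right - treeSum α N Q.right) with hu
      have hu' : a * ℓ Q - treeSum α (N + 1) Q = u - α Q := by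
        rw [treeSum, hℓ Q, hu]; ring
      have hαu : α Q ≤ u := by
        have := hcarl (N + 1) Q
        linarith
      have hu0 : 0 ≤ u := (hα Q).trans hαu
      -- The fraction to spend is `α Q / u`, at most `1` by the Carleson condition; if `u = 0` then
      -- `α Q = 0` and nothing is spent.
      obtain ⟨r, hr0, hr1, hr⟩ : ∃ r : ℝ, 0 ≤ r ∧ r ≤ 1 ∧ r * u = α Q := by
        rcases hu0.eq_or_lt with h0 | h0
        · exact ⟨0, le_rfl, zero_le_one, by rw [zero_mul]; linarith [hα Q]⟩
        · exact ⟨α Q / u, div_nonneg (hα Q) hu0, (div_le_one h0).2 hαu,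
            div_mul_cancel₀ _ h0.ne'⟩
      obtain ⟨hU, hM, hE⟩ := hV.regularizedEnergy_step hC0 hC Q hU₁ hU₂ hM₁ hM₂ hr0 hr1
      obtain ⟨hU', hM', hE'⟩ := hV'.regularizedEnergy_step hC0 hC Q hU₁' hU₂' hM₁' hM₂' hr0 hr1
      have hP := hP₁.add hP₂
      rw [← hu] at hP
      refine ⟨_, _, hU, hU', hM, hM', ?_, ?_⟩
      · have := hP.smul (sub_nonneg.2 hr1)
        rwa [sub_mul, one_mul, hr, ← hu'] at this
      · have h1 := (hP.smul hr0).le_mul_add_inv_mul ht ((V Q)⁻¹ *ᵥ F Q) ((V' Q)⁻¹ *ᵥ F' Q)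
        rw [hr] at h1
        have h2 : 0 ≤ b Q := mul_nonneg (hα Q) (norm_nonneg _)
        have h3 : b Q = α Q * ‖star ((V Q)⁻¹ *ᵥ F Q) ⬝ᵥ ((V' Q)⁻¹ *ᵥ F' Q)‖ := rfl
        have h4 := mul_le_mul_of_nonneg_left hE ht.le
        have h5 := mul_le_mul_of_nonneg_left hE' hti.le
        rw [treeSum, hV.energy_add Q, hV'.energy_add Q]
        linarith
  obtain ⟨U, U', -, -, hM, hM', -, hE⟩ := key N Q
  have h1 := mul_nonneg ht.le
    (mul_nonneg hC0.le (regularizedEnergy_nonneg (hV.posDef Q) hM (F Q)))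
  have h2 := mul_nonneg hti.le
    (mul_nonneg hC0.le (regularizedEnergy_nonneg (hV'.posDef Q) hM' (F' Q)))
  linarith

end TreeInduction

/-! ### Dyadic geometry; tree sums against unordered sums -/

namespace DyadicInterval

theorem toSet_subset_iff (P Q : DyadicInterval) : P.toSet ⊆ Q.toSet ↔
    (Q.pos : ℕ) * 2 ^ P.level ≤ P.pos * 2 ^ Q.level ∧
      ((P.pos : ℕ) + 1) * 2 ^ Q.level ≤ (Q.pos + 1) * 2 ^ P.level := by
  have hP : (0 : ℝ) < 2 ^ P.level := by positivity
  have hQ : (0 : ℝ) < 2 ^ Q.level := by positivity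
  rw [toSet, toSet, Set.Ico_subset_Ico_iff (by gcongr; linarith), div_le_div_iff₀ hQ hP,
    div_le_div_iff₀ hP hQ]
  exact_mod_cast Iff.rfl

theorem level_le_of_subset {P Q : DyadicInterval} (h : P.toSet ⊆ Q.toSet) :
    Q.level ≤ P.level := by
  obtain ⟨h1, h2⟩ := (toSet_subset_iff P Q).1 h
  have h3 : 2 ^ Q.level ≤ 2 ^ P.level := by linarith
  exact (Nat.pow_le_pow_iff_right (by norm_num)).1 h3

theorem nonempty_toSet (Q : DyadicInterval) : Q.toSet.Nonempty :=
  Set.nonempty_Ico.2 (by gcongr; linarith)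

theorem measurableSet_toSet (Q : DyadicInterval) : MeasurableSet Q.toSet := measurableSet_Ico

theorem volume_toSet (Q : DyadicInterval) : volume Q.toSet = ENNReal.ofReal (1 / 2 ^ Q.level) := by
  rw [toSet, Real.volume_Ico]
  congr 1
  ring

theorem toSet_subset_Icc (Q : DyadicInterval) : Q.toSet ⊆ Set.Icc 0 1 := by
  have h : ((Q.pos : ℕ) : ℝ) + 1 ≤ 2 ^ Q.level := by exact_mod_cast Q.pos.2
  refine Set.Ico_subset_Icc_self.trans (Set.Icc_subset_Icc (by positivity) ?_)
  rw [div_le_one (by positivity)]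
  exact h

theorem toSet_left (Q : DyadicInterval) : Q.left.toSet =
    Set.Ico ((Q.pos : ℝ) / 2 ^ Q.level) (((Q.pos : ℝ) + 1 / 2) / 2 ^ Q.level) := by
  have h : (2 : ℝ) ^ Q.level ≠ 0 := by positivity
  simp only [toSet, left]
  push_cast
  congr 1 <;> rw [pow_succ] <;> field_simp

theorem toSet_right (Q : DyadicInterval) : Q.right.toSet =
    Set.Ico (((Q.pos : ℝ) + 1 / 2) / 2 ^ Q.level) (((Q.pos : ℝ) + 1) / 2 ^ Q.level) := by
  have h : (2 : ℝ) ^ Q.level ≠ 0 := by positivity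
  simp only [toSet, right]
  push_cast
  congr 1 <;> rw [pow_succ] <;> field_simp
  ring

theorem toSet_left_union_right (Q : DyadicInterval) :
    Q.left.toSet ∪ Q.right.toSet = Q.toSet := by
  rw [toSet_left, toSet_right, toSet]
  exact Set.Ico_union_Ico_eq_Ico (by gcongr; linarith) (by gcongr; norm_num)

theorem disjoint_left_right (Q : DyadicInterval) : Disjoint Q.left.toSet Q.right.toSet := by
  rw [toSet_left, toSet_right]
  exact Set.Ico_disjoint_Ico_same

theorem eq_or_subset_left_or_subset_right {P Q : DyadicInterval} (h : P.toSet ⊆ Q.toSet) :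
    P = Q ∨ P.toSet ⊆ Q.left.toSet ∨ P.toSet ⊆ Q.right.toSet := by
  obtain ⟨m, hm⟩ := Nat.exists_eq_add_of_le (level_le_of_subset h)
  rw [toSet_subset_iff] at h
  simp only [toSet_subset_iff, left, right]
  obtain ⟨k, p, hp⟩ := P
  obtain ⟨l, q, hq⟩ := Q
  simp only at h hm ⊢
  subst hm
  have hl : 0 < 2 ^ l := by positivity
  obtain ⟨h1, h2⟩ := h
  have h1' : q * 2 ^ m ≤ p := by
    refine Nat.le_of_mul_le_mul_right ?_ hl
    rw [pow_add] at h1; linarith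
  have h2' : p + 1 ≤ (q + 1) * 2 ^ m := by
    refine Nat.le_of_mul_le_mul_right ?_ hl
    rw [pow_add] at h2; linarith
  cases m with
  | zero =>
    left
    have : p = q := by omega
    subst this
    rfl
  | succ m =>
    right
    rw [pow_succ] at h1' h2'
    -- `(2 * q + 1) * 2 ^ m` is the midpoint of `Q` in units of the length of `P`.
    rcases Nat.lt_or_ge p ((2 * q + 1) * 2 ^ m) with h3 | h3
    · left
      constructor
      · calc 2 * q * 2 ^ (l + (m + 1)) = (q * (2 ^ m * 2)) * 2 ^ (l + 1) := by ring
          _ ≤ _ := Nat.mul_le_mul_right _ h1'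
      · calc (p + 1) * 2 ^ (l + 1) ≤ ((2 * q + 1) * 2 ^ m) * 2 ^ (l + 1) :=
              Nat.mul_le_mul_right _ h3
          _ = _ := by ring
    · right
      constructor
      · calc (2 * q + 1) * 2 ^ (l + (m + 1)) = ((2 * q + 1) * 2 ^ m) * 2 ^ (l + 1) := by ring
          _ ≤ _ := Nat.mul_le_mul_right _ h3
      · calc (p + 1) * 2 ^ (l + 1) ≤ ((q + 1) * (2 ^ m * 2)) * 2 ^ (l + 1) :=
              Nat.mul_le_mul_right _ h2'
          _ = _ := by ring

theorem left_subset (Q : DyadicInterval) : Q.left.toSet ⊆ Q.toSet := by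
  rw [← toSet_left_union_right Q]; exact Set.subset_union_left

theorem right_subset (Q : DyadicInterval) : Q.right.toSet ⊆ Q.toSet := by
  rw [← toSet_left_union_right Q]; exact Set.subset_union_right

/-- No interval is counted twice: the halves are disjoint, and `Q` lies in neither because of its
level. -/
theorem treeSum_le_tsum (a : DyadicInterval → ℝ≥0∞) (N : ℕ) (Q : DyadicInterval) :
    treeSum a N Q ≤ ∑' P : {P : DyadicInterval // P.toSet ⊆ Q.toSet}, a P := by
  induction N generalizing Q with
  | zero => exact zero_le
  | succ N ih =>
    have hs : ∀ K : DyadicInterval, ∑' P : {P : DyadicInterval // P.toSet ⊆ K.toSet}, a P =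
        ∑' P, {P : DyadicInterval | P.toSet ⊆ K.toSet}.indicator a P := fun K =>
      tsum_subtype {P : DyadicInterval | P.toSet ⊆ K.toSet} a
    have hQ : a Q = ∑' P, ({Q} : Set DyadicInterval).indicator a P := by
      rw [← tsum_subtype, tsum_singleton]
    rw [treeSum]
    refine (add_le_add_right (add_le_add (ih Q.left) (ih Q.right)) _).trans ?_
    rw [hs, hs, hs, hQ, ← ENNReal.tsum_add, ← ENNReal.tsum_add]
    refine ENNReal.tsum_le_tsum fun P => ?_
    have hnl : Q.level < Q.left.level := Nat.lt_succ_self _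
    have hnr : Q.level < Q.right.level := Nat.lt_succ_self _
    classical
    simp only [Set.indicator_apply, Set.mem_singleton_iff, Set.mem_ofPred_eq]
    by_cases h0 : P = Q
    · subst h0
      have h1 : ¬ P.toSet ⊆ P.left.toSet := fun h => (level_le_of_subset h).not_gt hnl
      have h2 : ¬ P.toSet ⊆ P.right.toSet := fun h => (level_le_of_subset h).not_gt hnr
      simp [h1, h2]
    by_cases h1 : P.toSet ⊆ Q.left.toSet
    · have h2 : ¬ P.toSet ⊆ Q.right.toSet := fun h => by
        obtain ⟨x, hx⟩ := P.nonempty_toSet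
        exact Set.disjoint_left.1 Q.disjoint_left_right (h1 hx) (h hx)
      simp [h0, h1, h2, h1.trans Q.left_subset]
    · by_cases h2 : P.toSet ⊆ Q.right.toSet
      · simp [h0, h1, h2, h2.trans Q.right_subset]
      · simp [h0, h1, h2]

theorem sum_union_le_add [DecidableEq DyadicInterval] (a : DyadicInterval → ℝ≥0∞)
    (s t : Finset DyadicInterval) : ∑ P ∈ s ∪ t, a P ≤ ∑ P ∈ s, a P + ∑ P ∈ t, a P := by
  rw [← Finset.sum_union_inter]
  exact le_self_add

theorem sum_le_treeSum (a : DyadicInterval → ℝ≥0∞) (N : ℕ) (Q : DyadicInterval)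
    (s : Finset DyadicInterval) (hs : ∀ P ∈ s, P.toSet ⊆ Q.toSet ∧ P.level < Q.level + N) :
    ∑ P ∈ s, a P ≤ treeSum a N Q := by
  classical
  induction N generalizing Q s with
  | zero =>
    have : s = ∅ := Finset.eq_empty_of_forall_notMem fun P hP =>
      (level_le_of_subset (hs P hP).1).not_gt (hs P hP).2
    simp [this]
  | succ N ih =>
    rw [treeSum]
    have hsub : s ⊆ {Q} ∪ (s.filter (fun P => P.toSet ⊆ Q.left.toSet) ∪
        s.filter (fun P => P.toSet ⊆ Q.right.toSet)) := fun P hP => by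
      have := eq_or_subset_left_or_subset_right (hs P hP).1
      simp only [Finset.mem_union, Finset.mem_singleton, Finset.mem_filter]
      tauto
    refine (Finset.sum_le_sum_of_subset hsub).trans ((sum_union_le_add _ _ _).trans ?_)
    rw [Finset.sum_singleton]
    refine add_le_add_right ((sum_union_le_add _ _ _).trans (add_le_add ?_ ?_)) _
    · refine ih Q.left _ fun P hP => ?_
      rw [Finset.mem_filter] at hP
      exact ⟨hP.2, by have := (hs P hP.1).2; simp only [left]; omega⟩
    · refine ih Q.right _ fun P hP => ?_
      rw [Finset.mem_filter] at hP
      exact ⟨hP.2, by have := (hs P hP.1).2; simp only [right]; omega⟩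

/-- The unit interval. -/
def root : DyadicInterval := ⟨0, 0⟩

theorem toSet_root : root.toSet = Set.Ico 0 1 := by
  simp [root, toSet]

theorem subset_root (Q : DyadicInterval) : Q.toSet ⊆ root.toSet := by
  rw [toSet_subset_iff]
  simp [root]

theorem tsum_le_of_treeSum_le {a : DyadicInterval → ℝ≥0∞} {b : ℝ≥0∞}
    (h : ∀ N, treeSum a N root ≤ b) : ∑' Q, a Q ≤ b := by
  rw [ENNReal.tsum_eq_iSup_sum]
  refine iSup_le fun s => (sum_le_treeSum a (s.sup level + 1) root s fun P hP => ?_).trans (h _)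
  exact ⟨P.subset_root, by have := Finset.le_sup (f := level) hP; simp only [root]; omega⟩

theorem map_treeSum {R S : Type*} [AddMonoid R] [AddMonoid S] (φ : R →+ S)
    (a : DyadicInterval → R) (N : ℕ) (Q : DyadicInterval) :
    φ (treeSum a N Q) = treeSum (fun P => φ (a P)) N Q := by
  induction N generalizing Q with
  | zero => exact map_zero φ
  | succ N ih => simp only [treeSum, map_add, ih]

end DyadicInterval

/-! ### Integrals of weights as weighted families -/

section WeightedIntegrals

open DyadicInterval Matrix

theorem Matrix.quadForm_eq_sum {n : Type*} [Fintype n] (X : Matrix n n ℂ) (w : n → ℂ) :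
    quadForm X w = ∑ i, ∑ j, (star (w i) * X i j * w j).re := by
  simp only [quadForm, dotProduct, mulVec, Finset.mul_sum, Complex.re_sum, Pi.star_apply,
    mul_assoc]

theorem Matrix.IsHermitian.im_star_dotProduct_mulVec {n : Type*} [Fintype n] {X : Matrix n n ℂ}
    (hX : X.IsHermitian) (v : n → ℂ) : (star v ⬝ᵥ X *ᵥ v).im = 0 :=
  Complex.conj_eq_iff_im.1 (hX.star_dotProduct_mulVec v v).symm

theorem Matrix.quadForm_one {d : ℕ} (v : EuclideanSpace ℂ (Fin d)) :
    quadForm 1 v.ofLp = ‖v‖ ^ 2 := by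
  have h := inner_self_eq_norm_sq (𝕜 := ℂ) v
  rw [EuclideanSpace.inner_eq_star_dotProduct, dotProduct_comm] at h
  rw [quadForm, one_mulVec, ← h]
  rfl

-- Composing with the absolute value extends the square root continuously to all matrices, which
-- yields measurability of `V^{1/2}`.
open scoped Matrix.Norms.L2Operator in
theorem Matrix.continuous_sqrt_abs {n : Type*} [Fintype n] [DecidableEq n] :
    Continuous (fun X : Matrix n n ℂ => CFC.sqrt (CFC.abs X)) :=
  CFC.continuousOn_sqrt.comp_continuous CFC.continuous_abs fun X => CFC.abs_nonneg X

theorem DyadicInterval.volume_real_pos (Q : DyadicInterval) : 0 < volume.real Q.toSet := by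
  rw [measureReal_def, volume_toSet, ENNReal.toReal_ofReal (by positivity)]
  positivity

theorem DyadicInterval.volume_ne_top (Q : DyadicInterval) : volume Q.toSet ≠ ∞ := by
  rw [volume_toSet]; exact ENNReal.ofReal_ne_top

theorem MeasureTheory.Integrable.integrableOn_dyadic {E : Type*} [NormedAddCommGroup E]
    {f : ℝ → E} (hf : Integrable f unitVolume) (Q : DyadicInterval) :
    IntegrableOn f Q.toSet :=
  hf.mono_measure (Measure.restrict_mono Q.toSet_subset_Icc le_rfl)

theorem DyadicInterval.ae_restrict {p : ℝ → Prop} (h : ∀ᵐ x ∂unitVolume, p x)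
    (Q : DyadicInterval) : ∀ᵐ x ∂volume.restrict Q.toSet, p x :=
  ae_restrict_of_ae_restrict_of_subset Q.toSet_subset_Icc h

theorem DyadicInterval.isAdditive_setIntegral {E : Type*} [NormedAddCommGroup E] [NormedSpace ℝ E]
    {f : ℝ → E} (hf : Integrable f unitVolume) : IsAdditive fun Q => ∫ x in Q.toSet, f x :=
  fun Q => by
    beta_reduce
    rw [← Q.toSet_left_union_right]
    exact setIntegral_union Q.disjoint_left_right Q.right.measurableSet_toSet
      (hf.integrableOn_dyadic _) (hf.integrableOn_dyadic _)

/-- The entrywise integral of a matrix function over a dyadic interval. -/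
noncomputable def matrixIntegral {d : ℕ} (V : ℝ → Matrix (Fin d) (Fin d) ℂ) (Q : DyadicInterval) :
    Matrix (Fin d) (Fin d) ℂ :=
  Matrix.of fun i j => ∫ x in Q.toSet, V x i j

/-- The coordinatewise integral of `V^{1/2} f` over a dyadic interval. -/
noncomputable def sqrtIntegral {d : ℕ} (V : ℝ → Matrix (Fin d) (Fin d) ℂ)
    (f : ℝ → EuclideanSpace ℂ (Fin d)) (Q : DyadicInterval) : Fin d → ℂ :=
  fun i => ∫ x in Q.toSet, (CFC.sqrt (V x) *ᵥ (f x).ofLp) i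

section Weight

variable {d : ℕ} {V : ℝ → Matrix (Fin d) (Fin d) ℂ}

theorem integrable_quadForm (hV : ∀ i j, Integrable (fun x => V x i j) unitVolume)
    (w : Fin d → ℂ) : Integrable (fun x => quadForm (V x) w) unitVolume := by
  simp only [quadForm_eq_sum]
  exact integrable_finsetSum _ fun i _ => integrable_finsetSum _ fun j _ =>
    (((hV i j).const_mul _).mul_const _).re

theorem quadForm_matrixIntegral (hV : ∀ i j, Integrable (fun x => V x i j) unitVolume)
    (Q : DyadicInterval) (w : Fin d → ℂ) :
    quadForm (matrixIntegral V Q) w = ∫ x in Q.toSet, quadForm (V x) w := by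
  have hint : ∀ i j, IntegrableOn (fun x => star (w i) * V x i j * w j) Q.toSet := fun i j =>
    (((hV i j).const_mul _).mul_const _).integrableOn_dyadic Q
  have hre : ∀ i j, IntegrableOn (fun x => (star (w i) * V x i j * w j).re) Q.toSet := fun i j =>
    (hint i j).re
  simp only [quadForm_eq_sum]
  rw [integral_finsetSum _ fun i _ => integrable_finsetSum _ fun j _ => hre i j]
  refine Finset.sum_congr rfl fun i _ => ?_
  rw [integral_finsetSum _ fun j _ => hre i j]
  refine Finset.sum_congr rfl fun j _ => ?_
  have h := integral_re (hint i j)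
  rw [integral_mul_const, integral_const_mul] at h
  exact h.symm

theorem posDef_matrixIntegral (hV : ∀ i j, Integrable (fun x => V x i j) unitVolume)
    (hp : ∀ᵐ x ∂unitVolume, (V x).PosDef) (Q : DyadicInterval) : (matrixIntegral V Q).PosDef := by
  have hpQ := Q.ae_restrict hp
  have hH : (matrixIntegral V Q).IsHermitian := by
    ext i j
    rw [conjTranspose_apply, matrixIntegral, of_apply, of_apply, Complex.star_def, ← integral_conj]
    refine integral_congr_ae ?_
    filter_upwards [hpQ] with x hx
    exact hx.isHermitian.apply i j
  refine PosDef.of_dotProduct_mulVec_pos hH fun w hw => ?_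
  have hpos : ∀ᵐ x ∂volume.restrict Q.toSet, 0 < quadForm (V x) w := by
    filter_upwards [hpQ] with x hx
    exact (Complex.lt_def.1 (hx.dotProduct_mulVec_pos hw)).1
  have h : 0 < quadForm (matrixIntegral V Q) w := by
    rw [quadForm_matrixIntegral hV, integral_pos_iff_support_of_nonneg_ae
      (hpos.mono fun x hx => hx.le) ((integrable_quadForm hV w).integrableOn_dyadic Q)]
    have h1 : (volume.restrict Q.toSet) (Function.support fun x => quadForm (V x) w) =
        (volume.restrict Q.toSet) Set.univ :=
      measure_congr (Filter.eventuallyEq_univ.2 (hpos.mono fun x hx => hx.ne'))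
    rw [h1, Measure.restrict_apply_univ, volume_toSet]
    simp
  exact Complex.lt_def.2 ⟨h, (hH.im_star_dotProduct_mulVec w).symm⟩

theorem aestronglyMeasurable_matrix {μ : Measure ℝ}
    (hV : ∀ i j, AEStronglyMeasurable (fun x => V x i j) μ) : AEStronglyMeasurable V μ := by
  have h : AEMeasurable (β := Fin d → Fin d → ℂ) (fun x i j => V x i j) μ :=
    aemeasurable_pi_iff.2 fun i => aemeasurable_pi_iff.2 fun j => (hV i j).aemeasurable
  exact h.aestronglyMeasurable

theorem aestronglyMeasurable_sqrt {μ : Measure ℝ}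
    (hV : ∀ i j, AEStronglyMeasurable (fun x => V x i j) μ) (hp : ∀ᵐ x ∂μ, (V x).PosSemidef) :
    AEStronglyMeasurable (fun x => CFC.sqrt (V x)) μ := by
  refine (continuous_sqrt_abs.comp_aestronglyMeasurable (aestronglyMeasurable_matrix hV)).congr ?_
  filter_upwards [hp] with x hx
  rw [CFC.abs_of_nonneg _ hx.nonneg]

theorem Matrix.star_sqrt_mulVec_dotProduct {n : Type*} [Fintype n] [DecidableEq n]
    {X : Matrix n n ℂ} (v w : n → ℂ) :
    star (CFC.sqrt X *ᵥ w) ⬝ᵥ v = star w ⬝ᵥ CFC.sqrt X *ᵥ v := by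
  have hS : (CFC.sqrt X).PosSemidef := nonneg_iff_posSemidef.1 (CFC.sqrt_nonneg X)
  rw [star_mulVec, hS.isHermitian.eq, ← dotProduct_mulVec]

theorem Matrix.PosSemidef.quadForm_one_sqrt_mulVec {n : Type*} [Fintype n] [DecidableEq n]
    {X : Matrix n n ℂ} (hX : X.PosSemidef) (w : n → ℂ) :
    quadForm 1 (CFC.sqrt X *ᵥ w) = quadForm X w := by
  rw [quadForm, one_mulVec, star_sqrt_mulVec_dotProduct, mulVec_mulVec,
    CFC.sqrt_mul_sqrt_self X hX.nonneg, quadForm]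

/-- Young's inequality for the pairing of `w` with `X^{1/2} v`. -/
theorem Matrix.PosSemidef.two_re_dotProduct_sqrt_mulVec_le {X : Matrix (Fin d) (Fin d) ℂ}
    (hX : X.PosSemidef) (v : EuclideanSpace ℂ (Fin d)) (w : Fin d → ℂ) :
    2 * (star w ⬝ᵥ CFC.sqrt X *ᵥ v.ofLp).re ≤ quadForm X w + ‖v‖ ^ 2 := by
  have h := PosSemidef.one.quadForm_nonneg (v.ofLp - CFC.sqrt X *ᵥ w)
  rw [isHermitian_one.quadForm_sub_vec, hX.quadForm_one_sqrt_mulVec, quadForm_one, one_mulVec,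
    star_sqrt_mulVec_dotProduct] at h
  linarith

/-- Young's inequality tested on a basis vector times a phase; it supplies the integrable majorant
for `V^{1/2} f`. -/
theorem Matrix.PosSemidef.norm_sqrt_mulVec_apply_le {X : Matrix (Fin d) (Fin d) ℂ}
    (hX : X.PosSemidef) (v : EuclideanSpace ℂ (Fin d)) (i : Fin d) :
    ‖(CFC.sqrt X *ᵥ v.ofLp) i‖ ≤ ‖X i i‖ + ‖v‖ ^ 2 := by
  obtain ⟨c, hc, hcz⟩ := Complex.exists_norm_eq_one_re_mul_eq_norm ((CFC.sqrt X *ᵥ v.ofLp) i)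
  have h := hX.two_re_dotProduct_sqrt_mulVec_le v (Pi.single i (star c))
  have h1 : quadForm X (Pi.single i (star c)) ≤ ‖X i i‖ := by
    have : (Pi.single i (star c) : Fin d → ℂ) = star c • Pi.single i 1 := by
      rw [← Pi.single_smul, smul_eq_mul, mul_one]
    rw [this, quadForm_smul_vec, norm_star, hc, quadForm]
    simpa [Pi.star_single] using Complex.re_le_norm (X i i)
  rw [Pi.star_single, star_star, single_dotProduct, hcz] at h
  linarith [norm_nonneg (X i i), norm_nonneg ((CFC.sqrt X *ᵥ v.ofLp) i)]

variable {f : ℝ → EuclideanSpace ℂ (Fin d)}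

theorem integrable_norm_sq (hf : MemLp f 2 unitVolume) :
    Integrable (fun x => ‖f x‖ ^ 2) unitVolume :=
  MemLp.integrable_norm_pow (p := 2) (by exact_mod_cast hf) two_ne_zero

theorem integrable_sqrt_mulVec (hV : ∀ i j, Integrable (fun x => V x i j) unitVolume)
    (hp : ∀ᵐ x ∂unitVolume, (V x).PosSemidef) (hf : MemLp f 2 unitVolume) (i : Fin d) :
    Integrable (fun x => (CFC.sqrt (V x) *ᵥ (f x).ofLp) i) unitVolume := by
  refine Integrable.mono' ((hV i i).norm.add (integrable_norm_sq hf)) ?_ ?_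
  · have hS := aestronglyMeasurable_sqrt (fun i j => (hV i j).aestronglyMeasurable) hp
    have hc : Continuous fun p : Matrix (Fin d) (Fin d) ℂ × EuclideanSpace ℂ (Fin d) =>
        (p.1 *ᵥ p.2.ofLp) i :=
      (continuous_apply i).comp (continuous_fst.matrix_mulVec (by fun_prop))
    exact hc.comp_aestronglyMeasurable (hS.prodMk hf.aestronglyMeasurable)
  · filter_upwards [hp] with x hx
    exact hx.norm_sqrt_mulVec_apply_le (f x) i

theorem re_star_dotProduct_sqrtIntegral (hV : ∀ i j, Integrable (fun x => V x i j) unitVolume)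
    (hp : ∀ᵐ x ∂unitVolume, (V x).PosSemidef) (hf : MemLp f 2 unitVolume) (Q : DyadicInterval)
    (w : Fin d → ℂ) :
    (star w ⬝ᵥ sqrtIntegral V f Q).re =
        ∫ x in Q.toSet, (star w ⬝ᵥ CFC.sqrt (V x) *ᵥ (f x).ofLp).re ∧
      IntegrableOn (fun x => (star w ⬝ᵥ CFC.sqrt (V x) *ᵥ (f x).ofLp).re) Q.toSet := by
  have hint : ∀ i, IntegrableOn (fun x => star w i * (CFC.sqrt (V x) *ᵥ (f x).ofLp) i) Q.toSet :=
    fun i => ((integrable_sqrt_mulVec hV hp hf i).const_mul _).integrableOn_dyadic Q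
  have hsum : IntegrableOn (fun x => star w ⬝ᵥ CFC.sqrt (V x) *ᵥ (f x).ofLp) Q.toSet :=
    integrable_finsetSum _ fun i _ => hint i
  refine ⟨?_, hsum.re⟩
  refine Eq.trans ?_ (integral_re hsum).symm
  simp only [dotProduct]
  rw [integral_finsetSum _ fun i _ => hint i]
  simp only [integral_const_mul]
  rfl

/-- The integrals of a weight and of a square integrable function form a weighted family. -/
theorem isWeightedFamily_integral (hV : ∀ i j, Integrable (fun x => V x i j) unitVolume)
    (hp : ∀ᵐ x ∂unitVolume, (V x).PosDef) (hf : MemLp f 2 unitVolume) :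
    IsWeightedFamily (matrixIntegral V) (sqrtIntegral V f)
      fun Q => ∫ x in Q.toSet, ‖f x‖ ^ 2 where
  posDef := posDef_matrixIntegral hV hp
  weight_add Q := by
    ext i j
    exact isAdditive_setIntegral (hV i j) Q
  vec_add Q := by
    ext i
    exact isAdditive_setIntegral
      (integrable_sqrt_mulVec hV (hp.mono fun x hx => hx.posSemidef) hf i) Q
  energy_add := isAdditive_setIntegral (integrable_norm_sq hf)
  le_energy Q := by
    have hp' := hp.mono fun x hx => hx.posSemidef
    set w := (matrixIntegral V Q)⁻¹ *ᵥ sqrtIntegral V f Q with hw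
    -- With the maximizer `w` fixed, both terms of the variational formula are integrals over `Q`,
    -- and Young's inequality applies pointwise.
    rw [← (posDef_matrixIntegral hV hp Q).two_re_dotProduct_sub_eq, ← hw]
    obtain ⟨h1, h2⟩ := re_star_dotProduct_sqrtIntegral hV hp' hf Q w
    have h3 := (integrable_quadForm hV w).integrableOn_dyadic Q
    have h4 := (integrable_norm_sq hf).integrableOn_dyadic Q
    rw [h1, quadForm_matrixIntegral hV, sub_le_iff_le_add', ← integral_const_mul,
      ← integral_add h3 h4]
    refine integral_mono_ae (h2.const_mul 2) (h3.add h4) ?_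
    filter_upwards [Q.ae_restrict hp'] with x hx
    exact hx.two_re_dotProduct_sqrt_mulVec_le (f x) w

theorem dominatesPairing_matrixIntegral
    (hV : ∀ i j, Integrable (fun x => V x i j) unitVolume)
    (hV' : ∀ i j, Integrable (fun x => (V x)⁻¹ i j) unitVolume)
    (hp : ∀ᵐ x ∂unitVolume, (V x).PosDef) (Q : DyadicInterval) :
    DominatesPairing (matrixIntegral V Q) (matrixIntegral (fun x => (V x)⁻¹) Q)
      (volume.real Q.toSet) := fun v w => by
  have h1 := (integrable_quadForm hV v).integrableOn_dyadic Q
  have h2 := (integrable_quadForm hV' w).integrableOn_dyadic Q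
  rw [quadForm_matrixIntegral hV, quadForm_matrixIntegral hV', ← integral_add h1 h2]
  have h3 : 2 * volume.real Q.toSet * ‖star v ⬝ᵥ w‖ =
      ∫ _ in Q.toSet, 2 * ‖star v ⬝ᵥ w‖ := by
    rw [setIntegral_const, smul_eq_mul]; ring
  rw [h3]
  refine integral_mono_ae (integrableOn_const Q.volume_ne_top) (h1.add h2) ?_
  filter_upwards [Q.ae_restrict hp] with x hx
  exact hx.two_norm_dotProduct_le v w

/-- The factors `|Q|` of the two averages cancel, so the additive integrals can replace averages. -/
theorem weightedAverage_eq (hV : ∀ i j, Integrable (fun x => V x i j) unitVolume)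
    (hp : ∀ᵐ x ∂unitVolume, (V x).PosDef) (hf : MemLp f 2 unitVolume) (Q : DyadicInterval) :
    (weightedAverage V f Q).ofLp = (matrixIntegral V Q)⁻¹ *ᵥ sqrtIntegral V f Q := by
  have hp' := hp.mono fun x hx => hx.posSemidef
  set c : ℝ := volume.real Q.toSet with hc
  have hc0 : (c : ℂ) ≠ 0 := Complex.ofReal_ne_zero.2 Q.volume_real_pos.ne'
  have hcinv : (c : ℂ)⁻¹ ≠ 0 := inv_ne_zero hc0
  have hM : matrixAverage V Q = (c : ℂ)⁻¹ • matrixIntegral V Q := by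
    ext i j
    simp only [matrixAverage, matrixIntegral, of_apply, Matrix.smul_apply]
    rw [setAverage_eq, ← hc, Complex.real_smul, smul_eq_mul, Complex.ofReal_inv]
  have hvint : IntegrableOn (fun x => Matrix.toEuclideanLin (CFC.sqrt (V x)) (f x)) Q.toSet := by
    refine (PiLp.continuousLinearEquiv 2 ℂ (fun _ : Fin d => ℂ)).integrable_comp_iff.1 ?_
    exact Integrable.of_eval fun i => (integrable_sqrt_mulVec hV hp' hf i).integrableOn_dyadic Q
  have hF : (vectorAverage (fun x => Matrix.toEuclideanLin (CFC.sqrt (V x)) (f x)) Q).ofLp =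
      (c : ℂ)⁻¹ • sqrtIntegral V f Q := by
    ext i
    rw [vectorAverage, setAverage_eq, ← hc, PiLp.smul_apply, Pi.smul_apply, Complex.real_smul,
      smul_eq_mul, Complex.ofReal_inv]
    congr 1
    exact ((EuclideanSpace.proj (𝕜 := ℂ) i).integral_comp_comm hvint).symm
  have hinv : ((c : ℂ)⁻¹ • matrixIntegral V Q)⁻¹ = (c : ℂ) • (matrixIntegral V Q)⁻¹ := by
    have := invertibleOfNonzero hcinv
    rw [inv_smul _ _ (posDef_matrixIntegral hV hp Q).isUnit_det, invOf_eq_inv, inv_inv]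
  rw [weightedAverage, toLpLin_apply, hM, hF, hinv, smul_mulVec, mulVec_smul, smul_smul,
    mul_inv_cancel₀ hc0, one_smul]

end Weight

end WeightedIntegrals

/-! ### Optimization in `t` and conclusion -/

theorem Real.le_two_mul_sqrt_mul_sqrt_of_forall {s K x y : ℝ} (hK : 0 ≤ K) (hx : 0 ≤ x)
    (hy : 0 ≤ y) (h : ∀ t : ℝ, 0 < t → s ≤ K * (t * x + t⁻¹ * y)) : s ≤ 2 * K * √x * √y := by
  -- The optimal `t = √y / √x` is perturbed by `ε` to allow `x` or `y` to vanish.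
  have key : ∀ ε : ℝ, 0 < ε → s ≤ K * ((√y + ε) * √x + (√x + ε) * √y) := fun ε hε => by
    have hx' : 0 < √x + ε := add_pos_of_nonneg_of_pos (Real.sqrt_nonneg x) hε
    have hy' : 0 < √y + ε := add_pos_of_nonneg_of_pos (Real.sqrt_nonneg y) hε
    refine (h ((√y + ε) / (√x + ε)) (div_pos hy' hx')).trans
      (mul_le_mul_of_nonneg_left (add_le_add ?_ ?_) hK)
    · rw [div_mul_eq_mul_div, div_le_iff₀ hx', mul_assoc]
      refine mul_le_mul_of_nonneg_left ?_ hy'.le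
      nlinarith [Real.mul_self_sqrt hx, Real.sqrt_nonneg x]
    · rw [inv_div, div_mul_eq_mul_div, div_le_iff₀ hy', mul_assoc]
      refine mul_le_mul_of_nonneg_left ?_ hx'.le
      nlinarith [Real.mul_self_sqrt hy, Real.sqrt_nonneg y]
  have hlim : Filter.Tendsto (fun ε : ℝ => K * ((√y + ε) * √x + (√x + ε) * √y))
      (nhdsWithin 0 (Set.Ioi 0)) (nhds (K * ((√y + 0) * √x + (√x + 0) * √y))) :=
    (Continuous.tendsto (by fun_prop) 0).mono_left nhdsWithin_le_nhds
  have := ge_of_tendsto hlim (Filter.eventually_of_mem self_mem_nhdsWithin key)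
  linarith

theorem eLpNorm_two_eq_sqrt_integral {d : ℕ} {f : ℝ → EuclideanSpace ℂ (Fin d)}
    (hf : MemLp f 2 unitVolume) :
    eLpNorm f 2 unitVolume = ENNReal.ofReal √(∫ x in DyadicInterval.root.toSet, ‖f x‖ ^ 2) := by
  rw [hf.eLpNorm_eq_integral_rpow_norm two_ne_zero ENNReal.ofNat_ne_top, Real.sqrt_eq_rpow,
    DyadicInterval.toSet_root, setIntegral_congr_set Ico_ae_eq_Icc, unitVolume]
  norm_num

/-- A Carleson sequence in terms of finite sums over generations. -/
theorem IsCarlesonSequence.treeSum_le {α : DyadicInterval → ℝ≥0} {A : ℝ≥0}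
    (h : IsCarlesonSequence α A) (N : ℕ) (Q : DyadicInterval) :
    DyadicInterval.treeSum (fun P => (α P : ℝ)) N Q ≤ A * volume.real Q.toSet := by
  have h0 : volume Q.toSet ≠ 0 := fun h0 =>
    Q.volume_real_pos.ne' (by rw [measureReal_def, h0, ENNReal.toReal_zero])
  have h1 : DyadicInterval.treeSum (fun P => (α P : ℝ≥0∞)) N Q ≤ A * volume Q.toSet := by
    refine (DyadicInterval.treeSum_le_tsum _ N Q).trans ?_
    have := h Q
    rwa [mul_comm, ← div_eq_mul_inv, ENNReal.div_le_iff h0 Q.volume_ne_top] at this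
  have h2 := DyadicInterval.map_treeSum ENNReal.ofNNRealHom.toAddMonoidHom α N Q
  have h3 := DyadicInterval.map_treeSum NNReal.toRealHom.toAddMonoidHom α N Q
  change ((DyadicInterval.treeSum α N Q : ℝ≥0) : ℝ≥0∞) = _ at h2
  change ((DyadicInterval.treeSum α N Q : ℝ≥0) : ℝ) = _ at h3
  have h4 := ENNReal.toReal_mono (ENNReal.mul_ne_top ENNReal.coe_ne_top Q.volume_ne_top)
    (h2.trans_le h1)
  rw [ENNReal.coe_toReal, ENNReal.toReal_mul, ENNReal.coe_toReal] at h4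
  exact h3.symm.trans_le h4

theorem theorem2p1 (d : ℕ) (A : ℝ≥0) :
    ∃ B : ℝ≥0, ∀ α : DyadicInterval → ℝ≥0, IsCarlesonSequence α A →
      ∀ W : ℝ → Matrix (Fin d) (Fin d) ℂ, IsMatrixWeight W →
        (∀ᵐ x ∂unitVolume, IsUnit (W x)) → (∀ i j, Integrable (fun x => (W x)⁻¹ i j) unitVolume) →
        ∀ f g : ℝ → EuclideanSpace ℂ (Fin d), MemLp f 2 unitVolume → MemLp g 2 unitVolume →
          ∑' Q : DyadicInterval, (α Q : ℝ≥0∞) *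
              ‖inner ℂ (weightedAverage W f Q) (weightedAverage (fun x => (W x)⁻¹) g Q)‖ₑ ≤
            B * eLpNorm f 2 unitVolume * eLpNorm g 2 unitVolume := by
  obtain ⟨K, hK0, hK⟩ := exists_treeSum_pairing_le (Fin d) A.coe_nonneg
  refine ⟨(2 * K).toNNReal, fun α hα W hW hunit hWinv f g hf hg => ?_⟩
  have hpos : ∀ᵐ x ∂unitVolume, (W x).PosDef := by
    filter_upwards [hW.posSemidef, hunit] with x hx hu
    exact hx.posDef_iff_isUnit.2 hu
  have hposinv : ∀ᵐ x ∂unitVolume, ((W x)⁻¹).PosDef := hpos.mono fun x hx => hx.inv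
  let b : DyadicInterval → ℝ≥0 := fun Q =>
    α Q * ‖inner ℂ (weightedAverage W f Q) (weightedAverage (fun x => (W x)⁻¹) g Q)‖₊
  have hℓ : DyadicInterval.IsAdditive fun Q => volume.real Q.toSet := fun Q => by
    beta_reduce
    rw [← Q.toSet_left_union_right]
    exact measureReal_union Q.disjoint_left_right Q.right.measurableSet_toSet
      Q.left.volume_ne_top Q.right.volume_ne_top
  refine DyadicInterval.tsum_le_of_treeSum_le fun N => ?_
  have hb : DyadicInterval.treeSum (fun Q => (b Q : ℝ)) N DyadicInterval.root ≤
      2 * K * √(∫ x in DyadicInterval.root.toSet, ‖f x‖ ^ 2) *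
        √(∫ x in DyadicInterval.root.toSet, ‖g x‖ ^ 2) := by
    refine Real.le_two_mul_sqrt_mul_sqrt_of_forall hK0.le
      (integral_nonneg fun x => sq_nonneg _) (integral_nonneg fun x => sq_nonneg _) fun t ht => ?_
    have h := hK _ _ _ _ _ _ (fun Q => (α Q : ℝ)) (fun Q => volume.real Q.toSet)
      (isWeightedFamily_integral hW.integrable hpos hf)
      (isWeightedFamily_integral hWinv hposinv hg) hℓ
      (dominatesPairing_matrixIntegral hW.integrable hWinv hpos)
      (fun Q => (α Q).coe_nonneg) hα.treeSum_le t ht N DyadicInterval.root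
    refine Eq.trans_le ?_ h
    congr 1
    funext Q
    rw [NNReal.coe_mul, coe_nnnorm, EuclideanSpace.inner_eq_star_dotProduct, dotProduct_comm,
      weightedAverage_eq hW.integrable hpos hf, weightedAverage_eq hWinv hposinv hg]
  -- The real bound is transferred to extended non-negative reals through the common `ℝ≥0`-valued
  -- tree sum.
  have h2 := DyadicInterval.map_treeSum ENNReal.ofNNRealHom.toAddMonoidHom b N DyadicInterval.root
  have h3 := DyadicInterval.map_treeSum NNReal.toRealHom.toAddMonoidHom b N DyadicInterval.root
  change ((DyadicInterval.treeSum b N _ : ℝ≥0) : ℝ≥0∞) = _ at h2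
  change ((DyadicInterval.treeSum b N _ : ℝ≥0) : ℝ) = _ at h3
  rw [eLpNorm_two_eq_sqrt_integral hf, eLpNorm_two_eq_sqrt_integral hg]
  have h4 := ENNReal.ofReal_le_ofReal (h3.trans_le hb)
  rw [ENNReal.ofReal_coe_nnreal, ENNReal.ofReal_mul (by positivity),
    ENNReal.ofReal_mul (by positivity), h2] at h4
  refine Eq.trans_le ?_ h4
  congr 1
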